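/- Let $A$ be a finite alphabet, $X=A^{\mathbb Z^2}$ with the product topology and product $\sigma$-algebra, and let $\sigma_1(x)_{(i,j)}=x_{(i+1,j)}$, $\sigma_2(x)_{(i,j)}=x_{(i,j+1)}$. Let $F:X\to X$ be a two-dimensional cellular automaton, i.e. a continuous map commuting with $\sigma_1$ and $\sigma_2$, and let $\mu$ be a probability measure on $X$ that is invariant under $\sigma_1$, $\sigma_2$ and $F$ (no ergodicity is needed). *Entropies.* For a finite measurable partition $\alpha$ put $H_\mu(\alpha)=-\sum_{C\in\alpha}\mu(C)\log\mu(C)$, $$h_\mu(F,\alpha)=\lim_{n\to\infty}\frac1n H_\mu\Big(\bigvee_{k=0}^{n-1}F^{-k}\alpha\Big),\qquad h_\mu(\sigma_1,\sigma_2)=\sup_\alpha\lim_{n\to\infty}\frac1{n^2}H_\mu\Big(\bigvee_{0\le i,j<n}\sigma_1^{-i}\sigma_2^{-j}\alpha\Big),$$ the supremum being over all finite measurable partitions. Let $\alpha_n$ be the partition of $X$ according to the coordinates in $\{0,\dots,n-1\}^2$, and define $$h^{2D}_\mu(F)=\liminf_{n\to\infty}\frac1n h_\mu(F,\alpha_n).$$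 *Directional Lyapunov exponents.* For $\theta\in\mathbb R$ and $p\in\mathbb Z^2$ let $W^\theta_p\subset\mathbb Z^2$ consist of all $q\in\mathbb Z^2$ with $\langle q-p,(\cos\theta,\sin\theta)\rangle\le 0$ together with the coordinatewise integer parts of the points of the real line through $p$ orthogonal to $(\cos\theta,\sin\theta)$. For $x\in X$ let $W^\theta_p(x)$ be the set of $y\in X$ that agree with $x$ on $W^\theta_p$. Put $$\Lambda_n^F(\theta)(x)=\min\big\{\|p\|_2 : p\in\mathbb Z^2,\ (0,0)\in W^\theta_p,\ F^k(W^\theta_p(x))\subset W^\theta_{(0,0)}(F^k(x))\text{ for all }1\le k\le n\big\},$$ $\Lambda_n^F(\theta)=\max_{x\in X}\Lambda_n^F(\theta)(x)$ and $\lambda(\theta)=\lim_{n\to\infty}\Lambda_n^F(\theta)/n$. Then the limits $\lambda(0),\lambda(\pi/2),\lambda(\pi),\lambda(3\pi/2)$ exist, and $$h^{2D}_\mu(F)\le h_\mu(\sigma_1,\sigma_2)\,\big(\lambda(0)+\lambda(\pi)+1\big)\big(\lambda(\pi/2)+\lambda(3\pi/2)+1\big).$$ -/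

import Mathlib

open Filter Topology MeasureTheory

noncomputable section

namespace CA2D

/-- Configurations on the square lattice with alphabet `A`
(with the product topology and the product σ-algebra). -/
abbrev Config (A : Type*) := ℤ × ℤ → A

/-- The horizontal shift. -/
def shiftH {A : Type*} (x : Config A) : Config A := fun p => x (p.1 + 1, p.2)

/-- The vertical shift. -/
def shiftV {A : Type*} (x : Config A) : Config A := fun p => x (p.1, p.2 + 1)

/-- A two-dimensional cellular automaton: a continuous self-map commuting with both shifts. -/
structure IsCellularAutomaton {A : Type*} [TopologicalSpace A] (F : Config A → Config A) :
    Prop where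
  continuous : Continuous F
  comm_shiftH : ∀ x, F (shiftH x) = shiftH (F x)
  comm_shiftV : ∀ x, F (shiftV x) = shiftV (F x)

/-! ### Entropy

A finite partition of `X` is given by a labelling `P : X → ι` with `ι` finite; its cells are the
fibres of `P`. The join of finitely many partitions is the labelling by tuples. -/

/-- Shannon entropy `-∑ μ(C) log μ(C)` of the finite partition into the fibres of `P`. -/
def partitionEntropy {X ι : Type*} [MeasurableSpace X] [Fintype ι] (μ : Measure X) (P : X → ι) :
    ℝ :=
  ∑ i, Real.negMulLog (μ.real (P ⁻¹' {i}))

/-- Entropy of the transformation `T` with respect to the partition `P`: the limit of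
`(1/n) H(⋁_{0 ≤ k < n} T^{-k} P)`. -/
def entropyWrt {X ι : Type*} [MeasurableSpace X] [Fintype ι] (μ : Measure X) (T : X → X)
    (P : X → ι) : ℝ :=
  limUnder atTop fun n : ℕ =>
    partitionEntropy μ (fun (x : X) (k : Fin n) => P (T^[(k : ℕ)] x)) / (n : ℝ)

/-- Entropy of the `ℤ²`-shift action with respect to the partition `P`: the limit of
`(1/n²) H(⋁_{0 ≤ i, j < n} σ₁^{-i} σ₂^{-j} P)`. -/
def shiftEntropyWrt {A ι : Type*} [MeasurableSpace A] [Fintype ι] (μ : Measure (Config A))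
    (P : Config A → ι) : ℝ :=
  limUnder atTop fun n : ℕ =>
    partitionEntropy μ
      (fun (x : Config A) (k : Fin n × Fin n) =>
        P (shiftH^[(k.1 : ℕ)] (shiftV^[(k.2 : ℕ)] x))) / (n : ℝ) ^ 2

/-- Metric entropy of the `ℤ²`-shift action: the supremum over all finite measurable
partitions. -/
def shiftEntropy {A : Type*} [MeasurableSpace A] (μ : Measure (Config A)) : EReal :=
  ⨆ (m : ℕ) (P : Config A → Fin m) (_ : Measurable P), (shiftEntropyWrt μ P : EReal)

/-- The partition into cylinders fixing the `n × n` square `{0, …, n-1}²`. -/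
def squareBlock {A : Type*} (n : ℕ) (x : Config A) : Fin n × Fin n → A :=
  fun k => x (((k.1 : ℕ) : ℤ), ((k.2 : ℕ) : ℤ))

/-- The always finite entropy: the lower limit of the entropies of `F` with respect to the
partitions into `n × n` squares, divided by `n`. It is taken in the extended reals, so that its
finiteness is not presupposed. -/
def alwaysFiniteEntropy {A : Type*} [Fintype A] [MeasurableSpace A] (μ : Measure (Config A))
    (F : Config A → Config A) : EReal :=
  liminf (fun n : ℕ => ((entropyWrt μ F (squareBlock (A := A) n) / (n : ℝ) : ℝ) : EReal)) atTop

/-! ### Directional Lyapunov exponents -/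

/-- The almost line through `p`: integer parts of the points of the real line through `p`
that makes the angle `θ` with the vertical. -/
def almostLine (θ : ℝ) (p : ℤ × ℤ) : Set (ℤ × ℤ) :=
  {q | ∃ t : ℝ, q = (⌊(p.1 : ℝ) - t * Real.sin θ⌋, ⌊(p.2 : ℝ) + t * Real.cos θ⌋)}

/-- The lattice half plane delimited by the almost line through `p`, with outer normal
direction `(cos θ, sin θ)`. -/
def halfPlane (θ : ℝ) (p : ℤ × ℤ) : Set (ℤ × ℤ) :=
  {q | ((q.1 : ℝ) - p.1) * Real.cos θ + ((q.2 : ℝ) - p.2) * Real.sin θ ≤ 0} ∪ almostLine θ p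

/-- The set of all configurations that agree with `x` on the half plane. -/
def halfPlaneSet {A : Type*} (θ : ℝ) (p : ℤ × ℤ) (x : Config A) : Set (Config A) :=
  {y | ∀ q ∈ halfPlane θ p, y q = x q}

/-- The propagation of information at `x` during `n` iterations in direction `θ`: the least
distance to the origin of a point `p`, whose half plane contains the origin, such that
the values on the half plane at `p` determine those of the first `n` iterates on the half plane
at the origin. -/
def propagationAt {A : Type*} (F : Config A → Config A) (n : ℕ) (θ : ℝ) (x : Config A) : ℝ :=
  sInf {s : ℝ | ∃ p : ℤ × ℤ, s = Real.sqrt ((p.1 : ℝ) ^ 2 + (p.2 : ℝ) ^ 2) ∧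
    (0, 0) ∈ halfPlane θ p ∧
    ∀ k : ℕ, 1 ≤ k → k ≤ n →
      F^[k] '' halfPlaneSet θ p x ⊆ halfPlaneSet θ (0, 0) (F^[k] x)}

/-- The maximal propagation of information over all configurations. -/
def propagation {A : Type*} (F : Config A → Config A) (n : ℕ) (θ : ℝ) : ℝ :=
  ⨆ x : Config A, propagationAt F n θ x

/-- The Lyapunov exponent in direction `θ`. -/
def lyapunovExponent {A : Type*} (F : Config A → Config A) (θ : ℝ) : ℝ :=
  limUnder atTop fun n : ℕ => propagation F n θ / (n : ℝ)

end CA2D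

end

/-! In a lattice direction `u` the half planes are `{q | ⟨u, q⟩ ≤ c}`, and the propagation
during `n` steps is the least `m` such that the first `n` iterates at the origin depend only
on `{q | ⟨u, q⟩ ≤ m}`. By commutation with the shifts, the first `n` iterates on the
`n × n` square are then determined by a rectangle with sides `a n = m(1, 0) + m(-1, 0) + n`
and `b n = m(0, 1) + m(0, -1) + n`, so that `h_μ(F, α_n) / n ≤ H(a n, b n) / n²` for the
entropy `H` of rectangles. Composition of iterates makes `m` subadditive in `n`, so the sides
grow like `(λ(0) + λ(π) + 1) n` and `(λ(π / 2) + λ(3π / 2) + 1) n` by Fekete's lemma;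
covering the rectangle by small squares bounds the right-hand side by the product of these
rates with the entropy of the shift action. -/

namespace CA2D

open InformationTheory

/-! ### Shannon entropy of finite partitions -/

section NegMulLog

variable {ι κ : Type*}

lemma negMulLog_sum_le {s : Finset ι} {f : ι → ℝ} (hf : ∀ i ∈ s, 0 ≤ f i) :
    Real.negMulLog (∑ i ∈ s, f i) ≤ ∑ i ∈ s, Real.negMulLog (f i) := by
  simp only [Real.negMulLog, neg_mul, Finset.sum_neg_distrib, Finset.sum_mul, neg_le_neg_iff]
  refine Finset.sum_le_sum fun i hi => ?_
  rcases (hf i hi).eq_or_lt with h | h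
  · simp [← h]
  · gcongr
    exact Finset.single_le_sum hf hi

lemma negMulLog_le_neg_mul_log_add_sub {p q : ℝ} (hp : 0 ≤ p) (hq : 0 ≤ q)
    (hac : q = 0 → p = 0) : Real.negMulLog p ≤ -(p * Real.log q) + (q - p) := by
  rcases hp.eq_or_lt with rfl | hp
  · simpa using hq
  have hq' : q ≠ 0 := fun h => hp.ne' (hac h)
  have key : 0 ≤ q * klFun (p / q) := mul_nonneg hq (klFun_nonneg (by positivity))
  have expand : q * klFun (p / q) = p * Real.log p - p * Real.log q + q - p := by
    rw [klFun_apply, Real.log_div hp.ne' hq']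
    field_simp
  rw [Real.negMulLog]
  linarith

theorem sum_negMulLog_le_neg_sum_mul_log [Fintype ι] {p q : ι → ℝ} (hp : ∀ i, 0 ≤ p i)
    (hq : ∀ i, 0 ≤ q i) (hac : ∀ i, q i = 0 → p i = 0) (hsum : ∑ i, q i ≤ ∑ i, p i) :
    ∑ i, Real.negMulLog (p i) ≤ -∑ i, p i * Real.log (q i) :=
  calc ∑ i, Real.negMulLog (p i)
      ≤ ∑ i, (-(p i * Real.log (q i)) + (q i - p i)) := Finset.sum_le_sum fun i _ =>
        negMulLog_le_neg_mul_log_add_sub (hp i) (hq i) (hac i)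
    _ = -∑ i, p i * Real.log (q i) + (∑ i, q i - ∑ i, p i) := by
        rw [Finset.sum_add_distrib, Finset.sum_neg_distrib, Finset.sum_sub_distrib]
    _ ≤ -∑ i, p i * Real.log (q i) := by linarith

theorem sum_negMulLog_le_add_marginals [Fintype ι] [Fintype κ] {r : ι × κ → ℝ}
    (hr : ∀ a, 0 ≤ r a) (hsum : ∑ a, r a ≤ 1) :
    ∑ a, Real.negMulLog (r a) ≤
      ∑ i, Real.negMulLog (∑ j, r (i, j)) + ∑ j, Real.negMulLog (∑ i, r (i, j)) := by
  set p : ι → ℝ := fun i => ∑ j, r (i, j)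
  set q : κ → ℝ := fun j => ∑ i, r (i, j)
  have hp : ∀ i, 0 ≤ p i := fun i => Finset.sum_nonneg fun j _ => hr _
  have hq : ∀ j, 0 ≤ q j := fun j => Finset.sum_nonneg fun i _ => hr _
  have hrp : ∀ a : ι × κ, p a.1 = 0 → r a = 0 := fun a h =>
    (Finset.sum_eq_zero_iff_of_nonneg fun j _ => hr _).1 h a.2 (Finset.mem_univ _)
  have hrq : ∀ a : ι × κ, q a.2 = 0 → r a = 0 := fun a h =>
    (Finset.sum_eq_zero_iff_of_nonneg fun i _ => hr (i, a.2)).1 h a.1 (Finset.mem_univ _)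
  have hmass : ∑ a : ι × κ, p a.1 * q a.2 ≤ ∑ a, r a := by
    rw [Fintype.sum_prod_type, ← Finset.sum_mul_sum, ← Fintype.sum_prod_type r,
      ← Fintype.sum_prod_type_right r]
    exact mul_le_of_le_one_left (Finset.sum_nonneg fun a _ => hr a) hsum
  have hlog : ∀ a : ι × κ,
      r a * Real.log (p a.1 * q a.2) = r a * Real.log (p a.1) + r a * Real.log (q a.2) := by
    intro a
    by_cases h : r a = 0
    · simp [h]
    · rw [Real.log_mul (mt (hrp a) h) (mt (hrq a) h), mul_add]
  calc ∑ a, Real.negMulLog (r a) ≤ -∑ a, r a * Real.log (p a.1 * q a.2) :=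
        sum_negMulLog_le_neg_sum_mul_log hr (fun a => mul_nonneg (hp _) (hq _))
          (fun a h => (mul_eq_zero.1 h).elim (hrp a) (hrq a)) hmass
    _ = -∑ a, r a * Real.log (p a.1) + -∑ a, r a * Real.log (q a.2) := by
        simp only [hlog, Finset.sum_add_distrib, neg_add]
    _ = ∑ i, Real.negMulLog (p i) + ∑ j, Real.negMulLog (q j) := by
        rw [Fintype.sum_prod_type, Fintype.sum_prod_type_right]
        simp only [Real.negMulLog, neg_mul, Finset.sum_neg_distrib, p, q, Finset.sum_mul]

end NegMulLog

section PartitionEntropy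

variable {X Y ι κ ξ : Type*} [MeasurableSpace X] [MeasurableSpace Y] [Fintype ι] [Fintype κ]
  [Fintype ξ] {μ : Measure X} {ν : Measure Y}

lemma partitionEntropy_nonneg [IsProbabilityMeasure μ] (P : X → ι) : 0 ≤ partitionEntropy μ P :=
  Finset.sum_nonneg fun _ _ => Real.negMulLog_nonneg measureReal_nonneg measureReal_le_one

variable [MeasurableSpace ι] [MeasurableSingletonClass ι]

lemma partitionEntropy_comp_measurePreserving {T : X → Y} (hT : MeasurePreserving T μ ν)
    {P : Y → ι} (hP : Measurable P) : partitionEntropy μ (P ∘ T) = partitionEntropy ν P :=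
  Finset.sum_congr rfl fun i _ => congrArg Real.negMulLog <|
    hT.measureReal_preimage (hP (measurableSet_singleton i)).nullMeasurableSet

lemma measureReal_preimage_comp_singleton {η : Type*} [DecidableEq η] [IsFiniteMeasure μ]
    {P : X → ι} (hP : Measurable P) (g : ι → η) (k : η) :
    μ.real (g ∘ P ⁻¹' {k}) = ∑ i with g i = k, μ.real (P ⁻¹' {i}) := by
  rw [sum_measureReal_preimage_singleton _ fun i _ => hP (measurableSet_singleton i)]
  congr 1
  ext x
  simp

lemma partitionEntropy_comp_le [IsFiniteMeasure μ] {P : X → ι} (hP : Measurable P) (g : ι → κ) :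
    partitionEntropy μ (g ∘ P) ≤ partitionEntropy μ P := by
  classical
  calc ∑ k, Real.negMulLog (μ.real (g ∘ P ⁻¹' {k}))
      ≤ ∑ k, ∑ i with g i = k, Real.negMulLog (μ.real (P ⁻¹' {i})) :=
        Finset.sum_le_sum fun k _ => measureReal_preimage_comp_singleton (μ := μ) hP g k ▸
          negMulLog_sum_le fun _ _ => measureReal_nonneg
    _ = ∑ i, Real.negMulLog (μ.real (P ⁻¹' {i})) := Finset.sum_fiberwise _ _ _

lemma partitionEntropy_le_of_factorsThrough [IsFiniteMeasure μ] {P : X → ι} (hP : Measurable P)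
    {Q : X → κ} (h : Q.FactorsThrough P) : partitionEntropy μ Q ≤ partitionEntropy μ P := by
  rcases isEmpty_or_nonempty X with hX | ⟨⟨x⟩⟩
  · simp [partitionEntropy, Set.eq_empty_of_isEmpty]
  · have : Nonempty κ := ⟨Q x⟩
    obtain ⟨g, rfl⟩ := (Function.factorsThrough_iff Q).1 h
    exact partitionEntropy_comp_le hP g

variable [MeasurableSpace κ] [MeasurableSingletonClass κ]

lemma partitionEntropy_congr [IsFiniteMeasure μ] {P : X → ι} {Q : X → κ} (hP : Measurable P)
    (hQ : Measurable Q) (h : ∀ x y, P x = P y ↔ Q x = Q y) :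
    partitionEntropy μ P = partitionEntropy μ Q :=
  (partitionEntropy_le_of_factorsThrough hQ fun x y => (h x y).2).antisymm
    (partitionEntropy_le_of_factorsThrough hP fun x y => (h x y).1)

variable [IsProbabilityMeasure μ]

theorem partitionEntropy_prodMk_le {P : X → ι} {Q : X → κ} (hP : Measurable P)
    (hQ : Measurable Q) :
    partitionEntropy μ (fun x => (P x, Q x)) ≤ partitionEntropy μ P + partitionEntropy μ Q := by
  classical
  have hPQ := hP.prodMk hQ
  let r : ι × κ → ℝ := fun a => μ.real ((fun x => (P x, Q x)) ⁻¹' {a})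
  have mass : ∑ a, r a ≤ 1 :=
    (sum_measureReal_preimage_singleton _ fun a _ => hPQ (measurableSet_singleton a)).trans_le
      measureReal_le_one
  have fst : ∀ i, ∑ j, r (i, j) = μ.real (P ⁻¹' {i}) := fun i =>
    calc ∑ j, r (i, j) = ∑ a with a.1 = i, r a := by
          simp [Finset.sum_filter, Fintype.sum_prod_type_right]
      _ = μ.real (P ⁻¹' {i}) := (measureReal_preimage_comp_singleton hPQ Prod.fst i).symm
  have snd : ∀ j, ∑ i, r (i, j) = μ.real (Q ⁻¹' {j}) := fun j =>
    calc ∑ i, r (i, j) = ∑ a with a.2 = j, r a := by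
          simp [Finset.sum_filter, Fintype.sum_prod_type]
      _ = μ.real (Q ⁻¹' {j}) := (measureReal_preimage_comp_singleton hPQ Prod.snd j).symm
  simpa only [partitionEntropy, fst, snd] using
    sum_negMulLog_le_add_marginals (r := r) (fun _ => measureReal_nonneg) mass

lemma partitionEntropy_le_add {P : X → ι} {Q : X → κ} {R : X → ξ} (hP : Measurable P)
    (hQ : Measurable Q) (h : ∀ x y, P x = P y → Q x = Q y → R x = R y) :
    partitionEntropy μ R ≤ partitionEntropy μ P + partitionEntropy μ Q :=
  (partitionEntropy_le_of_factorsThrough (hP.prodMk hQ) fun x y hxy =>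
    h x y (congrArg Prod.fst hxy) (congrArg Prod.snd hxy)).trans (partitionEntropy_prodMk_le hP hQ)

end PartitionEntropy

section Itinerary

variable {X ι : Type*}

/-- The cells of `P` visited by the first `n` points of the orbit under `T`, that is, the labelling
of the join `⋁_{0 ≤ k < n} T^{-k} P` from which `entropyWrt` is computed. -/
def itinerary (T : X → X) (P : X → ι) (n : ℕ) (x : X) : Fin n → ι :=
  fun k => P (T^[(k : ℕ)] x)

variable [MeasurableSpace X] [MeasurableSpace ι] {T : X → X} {P : X → ι}

lemma measurable_itinerary (hT : Measurable T) (hP : Measurable P) (n : ℕ) :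
    Measurable (itinerary T P n) :=
  measurable_pi_lambda _ fun k => hP.comp (hT.iterate k)

variable [Fintype ι] [MeasurableSingletonClass ι] {μ : Measure X} [IsProbabilityMeasure μ]

theorem subadditive_partitionEntropy_itinerary (hT : MeasurePreserving T μ μ)
    (hP : Measurable P) : Subadditive fun n => partitionEntropy μ (itinerary T P n) := by
  intro m n
  have meas := measurable_itinerary hT.measurable hP
  beta_reduce
  rw [← partitionEntropy_comp_measurePreserving (hT.iterate m) (meas n)]
  refine partitionEntropy_le_add (meas m) ((meas n).comp (hT.iterate m).measurable)
    fun x y past future => funext fun k => ?_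
  rcases lt_or_ge (k : ℕ) m with hk | hk
  · exact congrFun past ⟨k, hk⟩
  · have := congrFun future ⟨k - m, by omega⟩
    simpa only [itinerary, Function.comp_apply, ← Function.iterate_add_apply,
      Nat.sub_add_cancel hk] using this

lemma bddBelow_range_div_of_nonneg {u : ℕ → ℝ} (hu : ∀ n, 0 ≤ u n) :
    BddBelow (Set.range fun n : ℕ => u n / n) :=
  ⟨0, Set.forall_mem_range.2 fun n => div_nonneg (hu n) n.cast_nonneg⟩

theorem entropyWrt_le_div (hT : MeasurePreserving T μ μ) (hP : Measurable P) {n : ℕ}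
    (hn : n ≠ 0) : entropyWrt μ T P ≤ partitionEntropy μ (itinerary T P n) / n := by
  have fekete := subadditive_partitionEntropy_itinerary hT hP
  have bdd := bddBelow_range_div_of_nonneg fun n =>
    partitionEntropy_nonneg (μ := μ) (itinerary T P n)
  calc entropyWrt μ T P = fekete.lim := (fekete.tendsto_lim bdd).limUnder_eq
    _ ≤ partitionEntropy μ (itinerary T P n) / n := fekete.lim_le_div bdd hn

end Itinerary

/-! ### Subadditive functions of two variables -/

section Bisubadditive

lemma nonneg_of_subadditive_of_monotone {u : ℕ → ℝ} (hu : Subadditive u) (hmono : Monotone u)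
    (n : ℕ) : 0 ≤ u n := by
  have := (hmono (Nat.le_add_right n n)).trans (hu n n)
  linarith

lemma le_div_add_one_mul_of_subadditive_of_monotone {u : ℕ → ℝ} (hu : Subadditive u)
    (hmono : Monotone u) {m : ℕ} (hm : 0 < m) (n : ℕ) : u n ≤ ((n : ℝ) / m + 1) * u m := by
  have hum := nonneg_of_subadditive_of_monotone hu hmono m
  calc u n = u (n / m * m + n % m) := by rw [Nat.div_add_mod']
    _ ≤ (n / m : ℕ) * u m + u (n % m) := hu.apply_mul_add_le _ _ _
    _ ≤ (n : ℝ) / m * u m + u m := by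
        gcongr
        · exact Nat.cast_div_le
        · exact hmono (Nat.mod_lt n hm).le
    _ = ((n : ℝ) / m + 1) * u m := by ring

/-- Functions of the side lengths of a rectangle that are monotone and subadditive in each side,
the setting of the two-dimensional Fekete lemma. -/
structure IsMonotoneBisubadditive (H : ℕ → ℕ → ℝ) : Prop where
  mono_left : ∀ b, Monotone fun a => H a b
  mono_right : ∀ a, Monotone (H a)
  subadditive_left : ∀ b, Subadditive fun a => H a b
  subadditive_right : ∀ a, Subadditive (H a)

/-- The growth rate of `H` per unit of area, as an infimum over squares. -/
noncomputable def arealRate (H : ℕ → ℕ → ℝ) : ℝ :=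
  ⨅ m : ℕ+, H m m / (m : ℝ) ^ 2

namespace IsMonotoneBisubadditive

variable {H : ℕ → ℕ → ℝ}

lemma nonneg (hH : IsMonotoneBisubadditive H) (a b : ℕ) : 0 ≤ H a b :=
  nonneg_of_subadditive_of_monotone (hH.subadditive_right a) (hH.mono_right a) b

lemma le_mul_mul (hH : IsMonotoneBisubadditive H) {m : ℕ} (hm : 0 < m) (a b : ℕ) :
    H a b ≤ ((a : ℝ) / m + 1) * (((b : ℝ) / m + 1) * H m m) :=
  calc H a b ≤ ((a : ℝ) / m + 1) * H m b :=
        le_div_add_one_mul_of_subadditive_of_monotone (hH.subadditive_left b) (hH.mono_left b) hm a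
    _ ≤ ((a : ℝ) / m + 1) * (((b : ℝ) / m + 1) * H m m) := by
        gcongr
        exact le_div_add_one_mul_of_subadditive_of_monotone (hH.subadditive_right m)
          (hH.mono_right m) hm b

lemma arealRate_le (hH : IsMonotoneBisubadditive H) {m : ℕ} (hm : 0 < m) :
    arealRate H ≤ H m m / (m : ℝ) ^ 2 :=
  ciInf_le ⟨0, Set.forall_mem_range.2 fun m : ℕ+ => div_nonneg (hH.nonneg m m) (sq_nonneg (m : ℝ))⟩
    (⟨m, hm⟩ : ℕ+)

theorem eventually_div_sq_lt (hH : IsMonotoneBisubadditive H) {a b : ℕ → ℕ} {α β c : ℝ}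
    (ha : Tendsto (fun n => (a n : ℝ) / n) atTop (𝓝 α))
    (hb : Tendsto (fun n => (b n : ℝ) / n) atTop (𝓝 β)) (hc : α * β * arealRate H < c) :
    ∀ᶠ n : ℕ in atTop, H (a n) (b n) / (n : ℝ) ^ 2 < c := by
  have hα : 0 ≤ α := ge_of_tendsto' ha fun n => by positivity
  have hβ : 0 ≤ β := ge_of_tendsto' hb fun n => by positivity
  rw [arealRate, Real.mul_iInf_of_nonneg (mul_nonneg hα hβ)] at hc
  obtain ⟨m, hm⟩ := exists_lt_of_ciInf_lt hc
  have cover : Tendsto (fun n : ℕ => ((a n : ℝ) / n / m + (n : ℝ)⁻¹) *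
      (((b n : ℝ) / n / m + (n : ℝ)⁻¹) * H m m)) atTop (𝓝 (α * β * (H m m / (m : ℝ) ^ 2))) := by
    have inv := tendsto_inv_atTop_nhds_zero_nat (𝕜 := ℝ)
    convert ((ha.div_const (m : ℝ)).add inv).mul
      (((hb.div_const (m : ℝ)).add inv).mul_const (H m m)) using 2
    ring
  filter_upwards [cover.eventually_lt_const hm, eventually_gt_atTop 0] with n hlt hn
  calc H (a n) (b n) / (n : ℝ) ^ 2
      ≤ ((a n : ℝ) / m + 1) * (((b n : ℝ) / m + 1) * H m m) / (n : ℝ) ^ 2 := by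
        gcongr
        exact hH.le_mul_mul m.pos _ _
    _ = ((a n : ℝ) / n / m + (n : ℝ)⁻¹) * (((b n : ℝ) / n / m + (n : ℝ)⁻¹) * H m m) := by
        field_simp
    _ < c := hlt

theorem tendsto_arealRate (hH : IsMonotoneBisubadditive H) :
    Tendsto (fun n : ℕ => H n n / (n : ℝ) ^ 2) atTop (𝓝 (arealRate H)) := by
  have one : Tendsto (fun n : ℕ => (n : ℝ) / n) atTop (𝓝 1) :=
    tendsto_const_nhds.congr' <| (eventually_ne_atTop 0).mono fun n hn =>
      (div_self (Nat.cast_ne_zero.2 hn)).symm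
  refine tendsto_order.2 ⟨fun c hc => ?_, fun c hc => ?_⟩
  · filter_upwards [eventually_gt_atTop 0] with n hn using hc.trans_le (hH.arealRate_le hn)
  · exact hH.eventually_div_sq_lt one one (by simpa using hc)

end IsMonotoneBisubadditive

end Bisubadditive

/-! ### Translations of configurations -/

section Translation

variable {A : Type*}

/-- The action of the lattice vector `v` on configurations by shifts. -/
def translate (v : ℤ × ℤ) (x : Config A) : Config A := fun q => x (q + v)

lemma translate_translate (v w : ℤ × ℤ) (x : Config A) :
    translate v (translate w x) = translate (v + w) x :=
  funext fun q => congrArg x (add_assoc q v w)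

lemma translate_zero : (translate 0 : Config A → Config A) = id :=
  funext fun x => funext fun q => congrArg x (add_zero q)

lemma translate_neg_leftInverse (v : ℤ × ℤ) :
    Function.LeftInverse (translate (-v) : Config A → Config A) (translate v) := fun x => by
  rw [translate_translate, neg_add_cancel, translate_zero, id]

lemma translate_neg_rightInverse (v : ℤ × ℤ) :
    Function.RightInverse (translate (-v) : Config A → Config A) (translate v) := fun x => by
  rw [translate_translate, add_neg_cancel, translate_zero, id]

lemma shiftH_eq_translate : (shiftH : Config A → Config A) = translate (1, 0) := by
  funext x q
  simp [shiftH, translate, Prod.add_def]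

lemma shiftV_eq_translate : (shiftV : Config A → Config A) = translate (0, 1) := by
  funext x q
  simp [shiftV, translate, Prod.add_def]

lemma translate_iterate (v : ℤ × ℤ) (n : ℕ) :
    (translate v : Config A → Config A)^[n] = translate (n • v) := by
  induction n with
  | zero => rw [zero_nsmul, translate_zero, Function.iterate_zero]
  | succ n ih =>
    funext x
    rw [Function.iterate_succ_apply', ih, translate_translate, succ_nsmul']

lemma lattice_induction {p : ℤ × ℤ → Prop} (horizontal : p (1, 0)) (vertical : p (0, 1))
    (neg : ∀ v, p v → p (-v)) (add : ∀ v w, p v → p w → p (v + w)) (v : ℤ × ℤ) : p v := by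
  let S : AddSubgroup (ℤ × ℤ) :=
    { carrier := {v | p v}
      add_mem' := fun {v w} => add v w
      zero_mem' := add_neg_cancel ((1, 0) : ℤ × ℤ) ▸ add _ _ horizontal (neg _ horizontal)
      neg_mem' := fun {v} => neg v }
  have mem : v.1 • ((1, 0) : ℤ × ℤ) + v.2 • ((0, 1) : ℤ × ℤ) ∈ S :=
    S.add_mem (S.zsmul_mem horizontal _) (S.zsmul_mem vertical _)
  exact (by simpa using mem : v ∈ S)

variable [MeasurableSpace A]

lemma measurable_translate (v : ℤ × ℤ) : Measurable (translate v : Config A → Config A) :=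
  measurable_pi_lambda _ fun _ => measurable_pi_apply _

theorem measurePreserving_translate {μ : Measure (Config A)}
    (hμH : MeasurePreserving shiftH μ μ) (hμV : MeasurePreserving shiftV μ μ) (v : ℤ × ℤ) :
    MeasurePreserving (translate v) μ μ := by
  induction v using lattice_induction with
  | horizontal => exact shiftH_eq_translate (A := A) ▸ hμH
  | vertical => exact shiftV_eq_translate (A := A) ▸ hμV
  | neg v hv =>
    have := MeasurePreserving.map_of_comp
      ((translate_neg_leftInverse v).comp_eq_id ▸ MeasurePreserving.id μ)
      (measurable_translate (-v)) hv.measurable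
    rwa [hv.map_eq] at this
  | add v w hv hw => exact funext (translate_translate v w) ▸ hv.comp hw

end Translation

/-! ### Dependence of the iterates on half planes -/

section DependsOn

variable {ι β : Type*} {π : ι → Type*}

lemma dependsOn_inter {f : (∀ i, π i) → β} {s t : Set ι} (hs : DependsOn f s)
    (ht : DependsOn f t) : DependsOn f (s ∩ t) := by
  classical
  intro x y hxy
  calc f x = f (s.piecewise x y) := hs fun i hi => by simp [hi]
    _ = f y := ht fun i hi => by
      by_cases his : i ∈ s
      · simpa [his] using hxy i ⟨his, hi⟩
      · simp [his]

theorem exists_finset_dependsOn [∀ i, TopologicalSpace (π i)] [∀ i, DiscreteTopology (π i)]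
    [∀ i, Finite (π i)] [TopologicalSpace β] [DiscreteTopology β] {f : (∀ i, π i) → β}
    (hf : Continuous f) : ∃ I : Finset ι, DependsOn f (I : Set ι) := by
  classical
  have locally_constant : ∀ x, ∃ I : Finset ι, ∀ y, (∀ i ∈ I, y i = x i) → f y = f x := fun x => by
    obtain ⟨I, u, hu, hIu⟩ := isOpen_pi_iff.1 ((isOpen_discrete {f x}).preimage hf) x rfl
    exact ⟨I, fun y hy => hIu fun i hi => hy i hi ▸ (hu i hi).2⟩
  choose I hI using locally_constant
  obtain ⟨t, ht⟩ := isCompact_univ.elim_finite_subcover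
    (fun x => (I x : Set ι).pi fun i => {x i})
    (fun x => isOpen_set_pi (I x).finite_toSet fun i _ => isOpen_discrete _)
    fun x _ => Set.mem_iUnion.2 ⟨x, fun i _ => rfl⟩
  refine ⟨t.biUnion I, fun y z hyz => ?_⟩
  obtain ⟨x, hx, hyx⟩ : ∃ x ∈ t, ∀ i ∈ I x, y i = x i := by
    simpa using ht (Set.mem_univ y)
  have hzx : ∀ i ∈ I x, z i = x i := fun i hi =>
    (hyz i (Finset.mem_coe.2 (Finset.mem_biUnion.2 ⟨x, hx, hi⟩))).symm.trans (hyx i hi)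
  rw [hI x y hyx, hI x z hzx]

end DependsOn

section Reach

variable {A : Type*}

/-- The height of lattice points in direction `u`, as an additive map. -/
def height (u : ℤ × ℤ) : ℤ × ℤ →+ ℤ :=
  u.1 • AddMonoidHom.fst ℤ ℤ + u.2 • AddMonoidHom.snd ℤ ℤ

lemma height_apply (u q : ℤ × ℤ) : height u q = u.1 * q.1 + u.2 * q.2 := by
  simp [height]

/-- The values at the origin of the first `n` iterates of `F` depend only on the coordinates of
height at most `m` in direction `u`: during `n` steps information travels at most a distance `m`
against the direction `u`. -/
def IsReachBound (F : Config A → Config A) (u : ℤ × ℤ) (n m : ℕ) : Prop :=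
  ∀ k ≤ n, DependsOn (fun x : Config A => F^[k] x 0) {q | height u q ≤ m}

/-- The least distance that bounds the reach of the first `n` iterates of `F` in direction `u`.
As the infimum of a set of natural numbers it is `0` when there is no bound. -/
noncomputable def reach (F : Config A → Config A) (u : ℤ × ℤ) (n : ℕ) : ℕ :=
  sInf {m | IsReachBound F u n m}

variable {F : Config A → Config A} {u : ℤ × ℤ}

lemma reach_le {n m : ℕ} (hm : IsReachBound F u n m) : reach F u n ≤ m :=
  Nat.sInf_le hm

lemma dependsOn_iterate_zero (u : ℤ × ℤ) (m : ℕ) :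
    DependsOn (fun x : Config A => F^[0] x 0) {q | height u q ≤ m} :=
  fun _ _ hxy => hxy 0 (by simp)

lemma isReachBound_zero : IsReachBound F u 0 0 := fun k hk => by
  rw [Nat.le_zero.1 hk]
  exact dependsOn_iterate_zero u 0

variable [TopologicalSpace A]

lemma IsCellularAutomaton.commute_translate (hF : IsCellularAutomaton F) (v : ℤ × ℤ) :
    Function.Commute F (translate v) := by
  induction v using lattice_induction with
  | horizontal => exact shiftH_eq_translate (A := A) ▸ hF.comm_shiftH
  | vertical => exact shiftV_eq_translate (A := A) ▸ hF.comm_shiftV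
  | neg v hv =>
    exact hv.semiconj.inverses_right (translate_neg_rightInverse v) (translate_neg_leftInverse v)
  | add v w hv hw => exact funext (translate_translate v w) ▸ hv.comp_right hw

lemma IsReachBound.dependsOn {n m k : ℕ} (hm : IsReachBound F u n m) (hF : IsCellularAutomaton F)
    (hk : k ≤ n) (q : ℤ × ℤ) :
    DependsOn (fun x : Config A => F^[k] x q) {p | height u p ≤ height u q + m} := by
  intro x y hxy
  have value : ∀ z : Config A, F^[k] z q = F^[k] (translate q z) 0 := fun z => by
    rw [((hF.commute_translate q).iterate_left k).eq, translate, zero_add]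
  beta_reduce
  rw [value, value]
  refine hm k hk fun p (hp : height u p ≤ m) => hxy _ ?_
  rw [Set.mem_ofPred_eq, map_add]
  omega

lemma IsReachBound.add {n n' m m' : ℕ} (hm : IsReachBound F u n m) (hm' : IsReachBound F u n' m')
    (hF : IsCellularAutomaton F) : IsReachBound F u (n + n') (m + m') := by
  intro k hk x y hxy
  rcases le_total k n with h | h
  · refine hm k h fun q (hq : height u q ≤ m) => hxy q ?_
    rw [Set.mem_ofPred_eq]
    omega
  · obtain ⟨j, rfl⟩ := Nat.exists_eq_add_of_le' h
    simp only [Function.iterate_add_apply]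
    refine hm' j (by omega) fun q (hq : height u q ≤ m') => ?_
    refine hm.dependsOn hF le_rfl q fun p (hp : height u p ≤ height u q + m) => hxy p ?_
    rw [Set.mem_ofPred_eq]
    omega

variable [Finite A] [DiscreteTopology A]

lemma exists_isReachBound_one (hF : IsCellularAutomaton F) (u : ℤ × ℤ) :
    ∃ m, IsReachBound F u 1 m := by
  obtain ⟨I, hI⟩ := exists_finset_dependsOn ((continuous_apply (0 : ℤ × ℤ)).comp hF.continuous)
  obtain ⟨r, hr⟩ := (I.image (height u)).bddAbove
  refine ⟨r.toNat, fun k hk => ?_⟩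
  obtain rfl | rfl := Nat.le_one_iff_eq_zero_or_eq_one.1 hk
  · exact dependsOn_iterate_zero u _
  · refine hI.mono fun q hq => ?_
    exact (hr (Finset.mem_image_of_mem _ hq)).trans (Int.self_le_toNat r)

lemma exists_isReachBound (hF : IsCellularAutomaton F) (u : ℤ × ℤ) (n : ℕ) :
    ∃ m, IsReachBound F u n m := by
  induction n with
  | zero => exact ⟨0, isReachBound_zero⟩
  | succ n ih =>
    obtain ⟨m, hm⟩ := ih
    obtain ⟨r, hr⟩ := exists_isReachBound_one hF u
    exact ⟨m + r, hm.add hr hF⟩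

lemma isReachBound_reach (hF : IsCellularAutomaton F) (u : ℤ × ℤ) (n : ℕ) :
    IsReachBound F u n (reach F u n) :=
  Nat.sInf_mem (exists_isReachBound hF u n)

theorem subadditive_reach (hF : IsCellularAutomaton F) (u : ℤ × ℤ) :
    Subadditive fun n => (reach F u n : ℝ) := fun m n => by
  beta_reduce
  exact_mod_cast reach_le ((isReachBound_reach hF u m).add (isReachBound_reach hF u n) hF)

end Reach

/-! ### Lyapunov exponents in lattice directions -/

section LatticeDirection

/-- The unit vector at angle `θ` is the lattice vector `u`. This happens exactly for the multiples
of `π / 2`, where the almost lines are lattice lines. -/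
structure IsLatticeDirection (θ : ℝ) (u : ℤ × ℤ) : Prop where
  cos_eq : Real.cos θ = u.1
  sin_eq : Real.sin θ = u.2

lemma isLatticeDirection_zero : IsLatticeDirection 0 (1, 0) :=
  ⟨by simp, by simp⟩

lemma isLatticeDirection_pi_div_two : IsLatticeDirection (Real.pi / 2) (0, 1) :=
  ⟨by simp, by simp⟩

lemma isLatticeDirection_pi : IsLatticeDirection Real.pi (-1, 0) :=
  ⟨by simp, by simp⟩

lemma isLatticeDirection_three_mul_pi_div_two : IsLatticeDirection (3 * Real.pi / 2) (0, -1) := by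
  have : 3 * Real.pi / 2 = Real.pi / 2 + Real.pi := by ring
  constructor <;> simp [this, Real.cos_add_pi, Real.sin_add_pi]

namespace IsLatticeDirection

variable {θ : ℝ} {u : ℤ × ℤ}

lemma sq_add_sq (h : IsLatticeDirection θ u) : u.1 ^ 2 + u.2 ^ 2 = 1 := by
  have := Real.cos_sq_add_sin_sq θ
  rw [h.cos_eq, h.sin_eq] at this
  exact_mod_cast this

lemma eq_zero_or_eq_zero (h : IsLatticeDirection θ u) : u.1 = 0 ∨ u.2 = 0 := by
  by_contra! hne
  have := h.sq_add_sq
  have := sq_pos_of_ne_zero hne.1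
  have := sq_pos_of_ne_zero hne.2
  omega

lemma height_self (h : IsLatticeDirection θ u) : height u u = 1 := by
  rw [height_apply, ← sq, ← sq, h.sq_add_sq]

theorem mem_halfPlane (h : IsLatticeDirection θ u) {p q : ℤ × ℤ} :
    q ∈ halfPlane θ p ↔ height u q ≤ height u p := by
  have below : ((q.1 : ℝ) - p.1) * Real.cos θ + ((q.2 : ℝ) - p.2) * Real.sin θ ≤ 0 ↔
      height u q ≤ height u p := by
    rw [h.cos_eq, h.sin_eq, height_apply, height_apply]
    norm_cast
    constructor <;> intro <;> linarith
  have line : q ∈ almostLine θ p → height u q ≤ height u p := by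
    rintro ⟨t, rfl⟩
    rw [h.cos_eq, h.sin_eq, height_apply, height_apply]
    rcases h.eq_zero_or_eq_zero with h0 | h0 <;> simp [h0]
  exact ⟨fun hq => hq.elim below.1 line, fun hq => Or.inl (below.2 hq)⟩

lemma height_le_sqrt (h : IsLatticeDirection θ u) (p : ℤ × ℤ) :
    (height u p : ℝ) ≤ √((p.1 : ℝ) ^ 2 + (p.2 : ℝ) ^ 2) := by
  refine Real.le_sqrt_of_sq_le ?_
  have lagrange : (u.1 ^ 2 + u.2 ^ 2) * (p.1 ^ 2 + p.2 ^ 2) =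
      height u p ^ 2 + (u.1 * p.2 - u.2 * p.1) ^ 2 := by
    rw [height_apply]
    ring
  rw [h.sq_add_sq, one_mul] at lagrange
  have : height u p ^ 2 ≤ p.1 ^ 2 + p.2 ^ 2 :=
    lagrange ▸ le_add_of_nonneg_right (sq_nonneg _)
  exact_mod_cast this

lemma sqrt_nsmul (h : IsLatticeDirection θ u) (m : ℕ) :
    √(((m • u).1 : ℝ) ^ 2 + ((m • u).2 : ℝ) ^ 2) = m := by
  have : (m • u).1 ^ 2 + (m • u).2 ^ 2 = (m : ℤ) ^ 2 :=
    calc (m • u).1 ^ 2 + (m • u).2 ^ 2 = (m : ℤ) ^ 2 * (u.1 ^ 2 + u.2 ^ 2) := by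
          rw [Prod.smul_fst, Prod.smul_snd, nsmul_eq_mul, nsmul_eq_mul]
          ring
      _ = (m : ℤ) ^ 2 := by rw [h.sq_add_sq, mul_one]
  rw [show ((m • u).1 : ℝ) ^ 2 + ((m • u).2 : ℝ) ^ 2 = (m : ℝ) ^ 2 by exact_mod_cast this,
    Real.sqrt_sq m.cast_nonneg]

end IsLatticeDirection

end LatticeDirection

section Propagation

variable {A : Type*} {F : Config A → Config A} {θ : ℝ} {u : ℤ × ℤ} {n m : ℕ}

/-- The points `p` over which the minimum defining `propagationAt F n θ x` is taken. -/
def IsPropagationPoint (F : Config A → Config A) (n : ℕ) (θ : ℝ) (x : Config A) (p : ℤ × ℤ) :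
    Prop :=
  (0, 0) ∈ halfPlane θ p ∧
    ∀ k : ℕ, 1 ≤ k → k ≤ n → F^[k] '' halfPlaneSet θ p x ⊆ halfPlaneSet θ (0, 0) (F^[k] x)

lemma zero_mem_lowerBounds_propagationAt (x : Config A) :
    0 ∈ lowerBounds {s : ℝ | ∃ p : ℤ × ℤ, s = √((p.1 : ℝ) ^ 2 + (p.2 : ℝ) ^ 2) ∧
      IsPropagationPoint F n θ x p} := by
  rintro _ ⟨p, rfl, -⟩
  positivity

lemma propagationAt_nonneg (x : Config A) : 0 ≤ propagationAt F n θ x :=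
  Real.sInf_nonneg (zero_mem_lowerBounds_propagationAt x)

/-- If `m` is not a reach bound, two configurations witness it, and the half plane of a propagation
point at one of them cannot be contained in the half plane on which they agree. -/
lemma exists_forall_lt_height (h : IsLatticeDirection θ u) (hm : ¬IsReachBound F u n m) :
    ∃ x : Config A, ∀ p, IsPropagationPoint F n θ x p → (m : ℤ) < height u p := by
  simp only [IsReachBound, DependsOn, not_forall] at hm
  obtain ⟨k, hk, x, y, hxy, hne⟩ := hm
  have hk1 : 1 ≤ k := Nat.one_le_iff_ne_zero.2 fun hk0 =>
    hne (hk0 ▸ dependsOn_iterate_zero u m hxy)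
  refine ⟨x, fun p hp => ?_⟩
  by_contra! hlt
  have hy : y ∈ halfPlaneSet θ p x := fun q hq => (hxy q ((h.mem_halfPlane.1 hq).trans hlt)).symm
  exact hne (hp.2 k hk1 hk ⟨y, hy, rfl⟩ 0 (h.mem_halfPlane.2 le_rfl)).symm

variable [TopologicalSpace A]

lemma isPropagationPoint_nsmul (hF : IsCellularAutomaton F) (h : IsLatticeDirection θ u)
    (hm : IsReachBound F u n m) (x : Config A) : IsPropagationPoint F n θ x (m • u) := by
  have hmu : height u (m • u) = m := by rw [map_nsmul, h.height_self, nsmul_one]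
  have h0 : height u (0, 0) = 0 := map_zero (height u)
  refine ⟨h.mem_halfPlane.2 (by omega), ?_⟩
  rintro k - hk _ ⟨y, hy, rfl⟩ q hq
  rw [h.mem_halfPlane, h0] at hq
  refine hm.dependsOn hF hk q fun p (hp : height u p ≤ height u q + m) => hy p ?_
  rw [h.mem_halfPlane]
  omega

lemma propagationAt_le (hF : IsCellularAutomaton F) (h : IsLatticeDirection θ u)
    (hm : IsReachBound F u n m) (x : Config A) : propagationAt F n θ x ≤ m :=
  csInf_le ⟨0, zero_mem_lowerBounds_propagationAt x⟩
    ⟨m • u, (h.sqrt_nsmul m).symm, isPropagationPoint_nsmul hF h hm x⟩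

variable [Finite A] [DiscreteTopology A]

lemma exists_add_one_le_propagationAt (hF : IsCellularAutomaton F) (h : IsLatticeDirection θ u)
    (hm : ¬IsReachBound F u n m) : ∃ x : Config A, (m + 1 : ℝ) ≤ propagationAt F n θ x := by
  obtain ⟨x, hx⟩ := exists_forall_lt_height h hm
  refine ⟨x, le_csInf
    ⟨_, _, rfl, isPropagationPoint_nsmul hF h (isReachBound_reach hF u n) x⟩ ?_⟩
  rintro _ ⟨p, rfl, hp⟩
  exact le_trans (by exact_mod_cast hx p hp) (h.height_le_sqrt p)

theorem propagation_eq_reach (hF : IsCellularAutomaton F) (h : IsLatticeDirection θ u) (n : ℕ) :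
    propagation F n θ = reach F u n := by
  have le_reach := propagationAt_le hF h (isReachBound_reach hF u n)
  refine (Real.iSup_le le_reach (Nat.cast_nonneg _)).antisymm ?_
  rcases Nat.eq_zero_or_eq_succ_pred (reach F u n) with h0 | hsucc
  · rw [h0, Nat.cast_zero]
    exact Real.iSup_nonneg propagationAt_nonneg
  · have hnot : ¬IsReachBound F u n (reach F u n).pred := fun hm => by
      have := reach_le hm
      omega
    obtain ⟨x, hx⟩ := exists_add_one_le_propagationAt hF h hnot
    rw [hsucc, Nat.cast_succ]
    exact hx.trans (le_ciSup ⟨_, Set.forall_mem_range.2 le_reach⟩ x)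

theorem tendsto_reach_div (hF : IsCellularAutomaton F) (h : IsLatticeDirection θ u) :
    Tendsto (fun n : ℕ => (reach F u n : ℝ) / n) atTop (𝓝 (lyapunovExponent F θ)) := by
  simp only [lyapunovExponent, propagation_eq_reach hF h]
  exact tendsto_nhds_limUnder ⟨_, (subadditive_reach hF u).tendsto_lim
    (bddBelow_range_div_of_nonneg fun n => Nat.cast_nonneg _)⟩

theorem tendsto_propagation_div (hF : IsCellularAutomaton F) (h : IsLatticeDirection θ u) :
    Tendsto (fun n : ℕ => propagation F n θ / n) atTop (𝓝 (lyapunovExponent F θ)) := by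
  simpa only [propagation_eq_reach hF h] using tendsto_reach_div hF h

lemma tendsto_reach_add_reach_add_div (hF : IsCellularAutomaton F) {θ' : ℝ} {u' : ℤ × ℤ}
    (h : IsLatticeDirection θ u) (h' : IsLatticeDirection θ' u') :
    Tendsto (fun n : ℕ => ((reach F u n + reach F u' n + n : ℕ) : ℝ) / n) atTop
      (𝓝 (lyapunovExponent F θ + lyapunovExponent F θ' + 1)) := by
  refine (((tendsto_reach_div hF h).add (tendsto_reach_div hF h')).add_const 1).congr' ?_
  filter_upwards [eventually_ne_atTop 0] with n hn
  rw [← add_div, div_add_one (Nat.cast_ne_zero.2 hn)]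
  push_cast
  rfl

end Propagation

/-! ### Entropy of blocks of coordinates -/

section Block

variable {ι A : Type*} [DecidableEq ι] [Fintype A] [MeasurableSpace A]

/-- Entropy of the partition according to the coordinates in the finite set `S`. -/
noncomputable def blockEntropy (μ : Measure (ι → A)) (S : Finset ι) : ℝ :=
  partitionEntropy μ (S.restrict (π := fun _ => A))

variable [MeasurableSingletonClass A] {μ : Measure (ι → A)}

lemma partitionEntropy_le_blockEntropy [IsFiniteMeasure μ] {κ : Type*} [Fintype κ]
    {P : (ι → A) → κ} {S : Finset ι} (h : DependsOn P (S : Set ι)) :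
    partitionEntropy μ P ≤ blockEntropy μ S :=
  partitionEntropy_le_of_factorsThrough S.measurable_restrict (dependsOn_iff_factorsThrough.1 h)

lemma blockEntropy_mono [IsFiniteMeasure μ] : Monotone (blockEntropy μ) := fun S _ hST =>
  partitionEntropy_le_blockEntropy (S.dependsOn_restrict.mono hST)

lemma blockEntropy_union_le [IsProbabilityMeasure μ] (S T : Finset ι) :
    blockEntropy μ (S ∪ T) ≤ blockEntropy μ S + blockEntropy μ T :=
  partitionEntropy_le_add S.measurable_restrict T.measurable_restrict fun _ _ hS hT =>
    funext fun ⟨q, hq⟩ => (Finset.mem_union.1 hq).elim (fun h => congrFun hS ⟨q, h⟩)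
      fun h => congrFun hT ⟨q, h⟩

end Block

section Rect

open scoped Pointwise

/-- The discrete rectangle `{0, …, a - 1} × {0, …, b - 1}`. -/
noncomputable def rect (a b : ℕ) : Finset (ℤ × ℤ) := Finset.Ico 0 (a : ℤ) ×ˢ Finset.Ico 0 (b : ℤ)

lemma mem_rect {a b : ℕ} {q : ℤ × ℤ} :
    q ∈ rect a b ↔ (0 ≤ q.1 ∧ q.1 < a) ∧ 0 ≤ q.2 ∧ q.2 < b := by
  rw [rect, Finset.mem_product, Finset.mem_Ico, Finset.mem_Ico]

lemma mem_vadd_rect {a b : ℕ} {v q : ℤ × ℤ} :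
    q ∈ v +ᵥ rect a b ↔ (v.1 ≤ q.1 ∧ q.1 < v.1 + a) ∧ v.2 ≤ q.2 ∧ q.2 < v.2 + b := by
  rw [← Finset.neg_vadd_mem_iff, mem_rect, vadd_eq_add, Prod.fst_add, Prod.snd_add, Prod.fst_neg,
    Prod.snd_neg]
  omega

variable {A : Type*} [Fintype A] [MeasurableSpace A] {μ : Measure (Config A)}

/-- Entropy of the partition according to the coordinates in a rectangle, as a function of its side
lengths. -/
noncomputable def rectEntropy (μ : Measure (Config A)) (a b : ℕ) : ℝ :=
  blockEntropy μ (rect a b)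

variable [MeasurableSingletonClass A]

lemma blockEntropy_vadd_le [IsFiniteMeasure μ] {v : ℤ × ℤ}
    (hμ : MeasurePreserving (translate v) μ μ) (S : Finset (ℤ × ℤ)) :
    blockEntropy μ (v +ᵥ S) ≤ blockEntropy μ S := by
  rw [blockEntropy, blockEntropy, ← partitionEntropy_comp_measurePreserving hμ
    S.measurable_restrict]
  refine partitionEntropy_le_of_factorsThrough (S.measurable_restrict.comp hμ.measurable) ?_
  refine fun x y hxy => funext fun q => ?_
  obtain ⟨p, hp, hpq⟩ := Finset.mem_vadd_finset.1 q.2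
  have := congrFun hxy ⟨p, hp⟩
  simpa [translate, add_comm p v, ← vadd_eq_add, hpq] using this

variable [IsProbabilityMeasure μ]

theorem isMonotoneBisubadditive_rectEntropy (hμ : ∀ v, MeasurePreserving (translate v) μ μ) :
    IsMonotoneBisubadditive (rectEntropy μ) where
  mono_left b a a' h := blockEntropy_mono fun q hq => by
    rw [mem_rect] at hq ⊢
    omega
  mono_right a b b' h := blockEntropy_mono fun q hq => by
    rw [mem_rect] at hq ⊢
    omega
  subadditive_left b a a' := by
    have split : rect (a + a') b = rect a b ∪ (((a : ℤ), (0 : ℤ)) +ᵥ rect a' b) := by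
      ext q
      rw [Finset.mem_union, mem_vadd_rect, mem_rect, mem_rect]
      omega
    calc blockEntropy μ (rect (a + a') b)
        ≤ blockEntropy μ (rect a b) + blockEntropy μ (((a : ℤ), (0 : ℤ)) +ᵥ rect a' b) :=
          split ▸ blockEntropy_union_le _ _
      _ ≤ rectEntropy μ a b + rectEntropy μ a' b := by
          gcongr
          exacts [le_rfl, blockEntropy_vadd_le (hμ _) _]
  subadditive_right a b b' := by
    have split : rect a (b + b') = rect a b ∪ (((0 : ℤ), (b : ℤ)) +ᵥ rect a b') := by
      ext q
      rw [Finset.mem_union, mem_vadd_rect, mem_rect, mem_rect]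
      omega
    calc blockEntropy μ (rect a (b + b'))
        ≤ blockEntropy μ (rect a b) + blockEntropy μ (((0 : ℤ), (b : ℤ)) +ᵥ rect a b') :=
          split ▸ blockEntropy_union_le _ _
      _ ≤ rectEntropy μ a b + rectEntropy μ a b' := by
          gcongr
          exacts [le_rfl, blockEntropy_vadd_le (hμ _) _]

end Rect

section ShiftEntropy

variable {A ι : Type*}

lemma shiftH_iterate_shiftV_iterate_zero (i j : ℕ) (x : Config A) :
    shiftH^[i] (shiftV^[j] x) 0 = x (i, j) := by
  rw [shiftH_eq_translate, shiftV_eq_translate, translate_iterate, translate_iterate,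
    translate_translate]
  simp [translate]

lemma squareBlock_eq_squareBlock_iff {n : ℕ} {x y : Config A} :
    squareBlock n x = squareBlock n y ↔ ∀ q ∈ rect n n, x q = y q := by
  refine ⟨fun h => ?_, fun h => funext fun k => h _ (mem_rect.2 (by simp))⟩
  rintro ⟨i, j⟩ hq
  obtain ⟨⟨hi, hin⟩, hj, hjn⟩ := mem_rect.1 hq
  lift i to ℕ using hi
  lift j to ℕ using hj
  exact congrFun h (⟨i, by simpa using hin⟩, ⟨j, by simpa using hjn⟩)

lemma measurable_squareBlock [MeasurableSpace A] (n : ℕ) :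
    Measurable (squareBlock n : Config A → _) :=
  measurable_pi_lambda _ fun _ => measurable_pi_apply _

variable [Fintype A] [MeasurableSpace A] [MeasurableSingletonClass A] [Fintype ι]
  [MeasurableSpace ι] [MeasurableSingletonClass ι] {μ : Measure (Config A)}

lemma partitionEntropy_comp_squareBlock [IsFiniteMeasure μ] {e : A → ι}
    (he : Function.Injective e) (n : ℕ) :
    partitionEntropy μ (fun x => e ∘ squareBlock n x) = rectEntropy μ n n := by
  refine partitionEntropy_congr
    ((measurable_of_finite fun b : Fin n × Fin n → A => e ∘ b).comp (measurable_squareBlock n))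
    (rect n n).measurable_restrict fun x y => ?_
  rw [he.comp_left.eq_iff, squareBlock_eq_squareBlock_iff]
  simp [funext_iff]

variable [IsProbabilityMeasure μ]

theorem shiftEntropyWrt_eq_arealRate (hμ : ∀ v, MeasurePreserving (translate v) μ μ) {e : A → ι}
    (he : Function.Injective e) :
    shiftEntropyWrt μ (fun x => e (x 0)) = arealRate (rectEntropy μ) := by
  simp only [shiftEntropyWrt, shiftH_iterate_shiftV_iterate_zero]
  refine Tendsto.limUnder_eq ((isMonotoneBisubadditive_rectEntropy hμ).tendsto_arealRate.congr
    fun n => ?_)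
  rw [← partitionEntropy_comp_squareBlock he]
  rfl

theorem arealRate_rectEntropy_le_shiftEntropy (hμ : ∀ v, MeasurePreserving (translate v) μ μ) :
    (arealRate (rectEntropy μ) : EReal) ≤ shiftEntropy μ := by
  let e := Fintype.equivFin A
  have meas : Measurable fun x : Config A => e (x 0) :=
    (measurable_of_finite e).comp (measurable_pi_apply 0)
  rw [← shiftEntropyWrt_eq_arealRate hμ e.injective]
  exact le_iSup_of_le _ (le_iSup_of_le _ (le_iSup_of_le meas le_rfl))

end ShiftEntropy

/-! ### Entropy of the automaton -/

section Automaton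

open scoped Pointwise

variable {A : Type*} [TopologicalSpace A] [DiscreteTopology A] {F : Config A → Config A}

/-- The square is extended on each side by the reach in that direction. -/
lemma dependsOn_itinerary_squareBlock [Finite A] (hF : IsCellularAutomaton F) (n : ℕ) :
    DependsOn (itinerary F (squareBlock n) n)
      (((-(reach F (-1, 0) n : ℤ), -(reach F (0, -1) n : ℤ)) +ᵥ
        rect (reach F (1, 0) n + reach F (-1, 0) n + n)
          (reach F (0, 1) n + reach F (0, -1) n + n) : Finset (ℤ × ℤ)) : Set (ℤ × ℤ)) := by
  intro x y hxy
  funext k c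
  have side := fun u =>
    (isReachBound_reach hF u n).dependsOn hF k.2.le (((c.1 : ℕ) : ℤ), ((c.2 : ℕ) : ℤ))
  refine dependsOn_inter (dependsOn_inter (side (1, 0)) (side (-1, 0)))
    (dependsOn_inter (side (0, 1)) (side (0, -1))) fun q hq => hxy q ?_
  simp only [Set.mem_inter_iff, Set.mem_ofPred_eq, height_apply] at hq
  rw [Finset.mem_coe, mem_vadd_rect]
  omega

variable [Fintype A] [MeasurableSpace A] [MeasurableSingletonClass A] {μ : Measure (Config A)}
  [IsProbabilityMeasure μ]

theorem entropyWrt_squareBlock_div_le (hF : IsCellularAutomaton F)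
    (hμ : ∀ v, MeasurePreserving (translate v) μ μ) (hμF : MeasurePreserving F μ μ) {n : ℕ}
    (hn : n ≠ 0) :
    entropyWrt μ F (squareBlock (A := A) n) / n ≤
      rectEntropy μ (reach F (1, 0) n + reach F (-1, 0) n + n)
        (reach F (0, 1) n + reach F (0, -1) n + n) / (n : ℝ) ^ 2 := by
  have block : partitionEntropy μ (itinerary F (squareBlock (A := A) n) n) ≤
      rectEntropy μ (reach F (1, 0) n + reach F (-1, 0) n + n)
        (reach F (0, 1) n + reach F (0, -1) n + n) :=
    (partitionEntropy_le_blockEntropy (dependsOn_itinerary_squareBlock hF n)).trans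
      (blockEntropy_vadd_le (hμ _) _)
  calc entropyWrt μ F (squareBlock (A := A) n) / n
      ≤ partitionEntropy μ (itinerary F (squareBlock n) n) / n / n := by
        gcongr
        exact entropyWrt_le_div hμF (measurable_squareBlock n) hn
    _ ≤ _ := by
        rw [div_div, ← sq]
        gcongr

theorem alwaysFiniteEntropy_le_mul_arealRate (hF : IsCellularAutomaton F)
    (hμ : ∀ v, MeasurePreserving (translate v) μ μ) (hμF : MeasurePreserving F μ μ) {α β : ℝ}
    (hα : Tendsto (fun n : ℕ => ((reach F (1, 0) n + reach F (-1, 0) n + n : ℕ) : ℝ) / n) atTop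
      (𝓝 α))
    (hβ : Tendsto (fun n : ℕ => ((reach F (0, 1) n + reach F (0, -1) n + n : ℕ) : ℝ) / n) atTop
      (𝓝 β)) :
    alwaysFiniteEntropy μ F ≤ ((α * β * arealRate (rectEntropy μ) : ℝ) : EReal) := by
  refine EReal.le_of_forall_lt_iff_le.1 fun c hc => ?_
  have small := (isMonotoneBisubadditive_rectEntropy hμ).eventually_div_sq_lt hα hβ
    (EReal.coe_lt_coe_iff.1 hc)
  refine liminf_le_of_frequently_le' (Eventually.frequently ?_)
  filter_upwards [small, eventually_ne_atTop 0] with n hlt hn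
  exact EReal.coe_le_coe_iff.2 ((entropyWrt_squareBlock_div_le hF hμ hμF hn).trans hlt.le)

end Automaton

end CA2D

theorem proposition4 {A : Type*} [Fintype A] [TopologicalSpace A] [DiscreteTopology A]
    [MeasurableSpace A] [MeasurableSingletonClass A]
    (F : CA2D.Config A → CA2D.Config A) (hF : CA2D.IsCellularAutomaton F)
    (μ : Measure (CA2D.Config A)) [IsProbabilityMeasure μ]
    (hμH : MeasurePreserving CA2D.shiftH μ μ) (hμV : MeasurePreserving CA2D.shiftV μ μ)
    (hμF : MeasurePreserving F μ μ) :
    (∀ θ ∈ ({0, Real.pi / 2, Real.pi, 3 * Real.pi / 2} : Set ℝ),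
      Tendsto (fun n : ℕ => CA2D.propagation F n θ / (n : ℝ)) atTop
        (𝓝 (CA2D.lyapunovExponent F θ))) ∧
    CA2D.alwaysFiniteEntropy μ F ≤
      CA2D.shiftEntropy μ *
        ((CA2D.lyapunovExponent F 0 + CA2D.lyapunovExponent F Real.pi + 1 : ℝ) : EReal) *
        ((CA2D.lyapunovExponent F (Real.pi / 2) +
          CA2D.lyapunovExponent F (3 * Real.pi / 2) + 1 : ℝ) : EReal) := by
  have hμ := CA2D.measurePreserving_translate hμH hμV
  refine ⟨?_, ?_⟩
  · rintro θ (rfl | rfl | rfl | rfl)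
    · exact CA2D.tendsto_propagation_div hF CA2D.isLatticeDirection_zero
    · exact CA2D.tendsto_propagation_div hF CA2D.isLatticeDirection_pi_div_two
    · exact CA2D.tendsto_propagation_div hF CA2D.isLatticeDirection_pi
    · exact CA2D.tendsto_propagation_div hF CA2D.isLatticeDirection_three_mul_pi_div_two
  · have width := CA2D.tendsto_reach_add_reach_add_div hF CA2D.isLatticeDirection_zero
      CA2D.isLatticeDirection_pi
    have length := CA2D.tendsto_reach_add_reach_add_div hF CA2D.isLatticeDirection_pi_div_two
      CA2D.isLatticeDirection_three_mul_pi_div_two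
    have width_nonneg := ge_of_tendsto' width fun n => by positivity
    have length_nonneg := ge_of_tendsto' length fun n => by positivity
    refine (CA2D.alwaysFiniteEntropy_le_mul_arealRate hF hμ hμF width length).trans ?_
    rw [mul_comm, ← mul_assoc, EReal.coe_mul, EReal.coe_mul]
    gcongr
    exact CA2D.arealRate_rectEntropy_le_shiftEntropy hμ
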